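/- Let $\mathcal H,\mathcal F,\mathcal Y$ be real Hilbert spaces, let $L:\mathscr D(L)\subset\mathcal H\to\mathcal F$ be a closed, densely defined linear operator with null space $N(L)$, range $R(L)$ and adjoint $L^*$, and let $H:\mathcal H\to\mathcal Y$ be a bounded linear operator. Let $\mathscr G_1\subset\mathcal F$ be convex, bounded, closed and balanced with $0\in\operatorname{int}\mathscr G_1$, and write $c(\mathscr G_1,z)=\sup\{(z,f):f\in\mathscr G_1\}$ for its support function. Observe $y=H\varphi+\eta$, where $\varphi\in\mathscr D(L)$ is unknown with $L\varphi\in\mathscr G_1$, and $\eta$ is a square-integrable random $\mathcal Y$-valued vector of unknown law with zero mean and $M(\eta,\eta)\le 1$ ($M$ denotes expectation). Let $\ell\in\mathcal H$. For an affine estimate $(u,y)+c$ of $(\ell,\varphi)$, with $u\in\mathcal Y$, $c\in\mathbb R$, put $$\sigma(\ell,u,c)=\sup_{L\varphi\in\mathscr G_1,\;\eta}M\big((\ell,\varphi)-(u,y)-c\big)^2\in[0,\infty],\qquad \sigma(\ell,u)=\inf_{c}\sigma(\ell,u,c),\qquad \hat\sigma(\ell)=\Big(\inf_{u,c}\sigma(\ell,u,c)\Big)^{1/2},$$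 the supremum over $\eta$ being over all admissible laws of the noise. A minimax estimate is an affine function $(\hat u,\cdot)+\hat c$ with $\sigma(\ell,\hat u,\hat c)=\inf_{u,c}\sigma(\ell,u,c)$; $\hat\sigma(\ell)$ is the minimax error. Let $\mathcal U_\ell=\{u\in\mathcal Y:\ell-H^*u\in R(L^*)\}$. Then $\hat\sigma(\ell)<\infty$ if and only if $\mathcal U_\ell\neq\varnothing$. Suppose $\mathcal U_\ell\ne\varnothing$. Then: 1. There is exactly one minimax estimate; it has the form $(\hat u,\cdot)$ (that is, $\hat c=0$) with $\hat u\in\mathcal U_\ell$. Moreover $\sigma(\ell,\hat u)=\min_u\sigma(\ell,u)$ and $\hat\sigma(\ell)=\sigma(\ell,\hat u)^{1/2}$. 2. For every $u\in\mathcal Y$, $$\sigma(\ell,u)=(u,u)+\min_z\{c^2(\mathscr G_1,z): z\in\mathscr D(L^*),\ L^*z=\ell-H^*u\},$$ where the minimum is attained if $u\in\mathcal U_\ell$, and is read as $+\infty$ (minimum over the empty set) otherwise. 3. Suppose in addition that $R(L)$ and $H(N(L))$ are closed. Let $P_{L^*}$ be the orthogonal projector onto $R(L^*)$ (which is then closed)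 and let $$I_2(w)=\min_z\{c^2(\mathscr G_1,z): z\in\mathscr D(L^*),\ L^*z=P_{L^*}(\ell-w)\},\qquad w\in\mathcal H .$$ This minimum is attained for every $w$, and $\hat u$ is characterized as follows: a vector $u\in\mathcal Y$ equals $\hat u$ if and only if $u\in\mathcal U_\ell$ and there is $p_0\in\mathscr D(L)$ with $$Lp_0=0,\qquad -2\,(u-Hp_0)\in H\big(\partial I_2(H^*u)\big),$$ where $\partial I_2(x)=\{p\in\mathcal H: I_2(y)\ge I_2(x)+(p,y-x)\ \text{for all } y\in\mathcal H\}$. -/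

import Mathlib

open MeasureTheory
open scoped ENNReal InnerProductSpace

namespace MinimaxEstimation

section Convex

variable {E : Type*} [NormedAddCommGroup E] [InnerProductSpace ℝ E]

/-- The support function `c(G, z) = sup {(z, f) : f ∈ G}`. -/
noncomputable def supportFun (G : Set E) (z : E) : EReal :=
  ⨆ f ∈ G, ((⟪z, f⟫_ℝ : ℝ) : EReal)

/-- The subdifferential `∂f(x)` of an extended-real-valued function. -/
def subdifferential (f : E → EReal) (x : E) : Set E :=
  {p | ∀ y, f x + ((⟪p, y - x⟫_ℝ : ℝ) : EReal) ≤ f y}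

end Convex

section Noise

variable {Y : Type*} [NormedAddCommGroup Y] [InnerProductSpace ℝ Y] [MeasurableSpace Y]

/-- `μ` is the law of a square-integrable random vector `η` in `Y` with zero mean and
`M(η, η) ≤ 1`. -/
structure IsNoiseLaw (μ : Measure Y) : Prop where
  isProbabilityMeasure : IsProbabilityMeasure μ
  memLp : MemLp (fun η : Y => η) 2 μ
  mean_zero : ∫ η, η ∂μ = 0
  second_moment_le : ∫ η, ⟪η, η⟫_ℝ ∂μ ≤ 1

end Noise

section Estimation

variable {X F Y : Type*}
  [NormedAddCommGroup X] [InnerProductSpace ℝ X] [CompleteSpace X]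
  [NormedAddCommGroup F] [InnerProductSpace ℝ F]
  [NormedAddCommGroup Y] [InnerProductSpace ℝ Y] [MeasurableSpace Y]

/-- The worst-case mean-squared error of the affine estimate `(u, y) + c` of `(ℓ, φ)` from the
observation `y = H φ + η`: the supremum of `M((ℓ, φ) - (u, y) - c)²` over all `φ` in the domain
of `L` with `L φ ∈ G` and over all admissible laws of the noise `η`. -/
noncomputable def errorWithShift (L : X →ₗ.[ℝ] F) (H : X →L[ℝ] Y) (G : Set F)
    (l : X) (u : Y) (c : ℝ) : ℝ≥0∞ :=
  ⨆ (φ : L.domain) (_ : L φ ∈ G) (μ : Measure Y) (_ : IsNoiseLaw μ),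
    ∫⁻ η, ENNReal.ofReal ((⟪l, (φ : X)⟫_ℝ - (⟪u, H φ + η⟫_ℝ + c)) ^ 2) ∂μ

/-- `σ(ℓ, u)`: the worst-case mean-squared error for the best choice of the constant `c`. -/
noncomputable def error (L : X →ₗ.[ℝ] F) (H : X →L[ℝ] Y) (G : Set F) (l : X) (u : Y) : ℝ≥0∞ :=
  ⨅ c : ℝ, errorWithShift L H G l u c

/-- The minimax mean-squared error in the direction `ℓ`: the square root of the infimum of the
worst-case mean-squared error over all affine estimates. -/
noncomputable def minimaxError (L : X →ₗ.[ℝ] F) (H : X →L[ℝ] Y) (G : Set F) (l : X) : ℝ≥0∞ :=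
  (⨅ (u : Y) (c : ℝ), errorWithShift L H G l u c) ^ (1 / 2 : ℝ)

/-- `(u, ·) + c` is a minimax mean-squared estimate of `(ℓ, φ)`. -/
def IsMinimaxEstimate (L : X →ₗ.[ℝ] F) (H : X →L[ℝ] Y) (G : Set F)
    (l : X) (u : Y) (c : ℝ) : Prop :=
  errorWithShift L H G l u c = ⨅ (u' : Y) (c' : ℝ), errorWithShift L H G l u' c'

/-- `inf {c(G, z)² : z ∈ D(L*), L* z = w}`, equal to `+∞` if `w ∉ R(L*)`. -/
noncomputable def minSupportSq [CompleteSpace F] (L : X →ₗ.[ℝ] F) (G : Set F) (w : X) : EReal :=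
  ⨅ (z : L.adjoint.domain) (_ : L.adjoint z = w), supportFun G (z : F) ^ 2

/-- The set `𝒰_ℓ` of all `u` such that `ℓ - H* u` lies in the range of `L*`. -/
def admissible [CompleteSpace F] [CompleteSpace Y] (L : X →ₗ.[ℝ] F) (H : X →L[ℝ] Y) (l : X) :
    Set Y :=
  {u | ∃ z : L.adjoint.domain, L.adjoint z = l - H.adjoint u}

/-- The orthogonal projector onto (the closure of) the range of `L*`. -/
noncomputable def rangeAdjointProj [CompleteSpace F] (L : X →ₗ.[ℝ] F) : X →L[ℝ] X :=
  (LinearMap.range L.adjoint.toFun).topologicalClosure.starProjection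

/-- `I₂(w) = inf {c(G, z)² : L* z = P (ℓ - w)}`, `P` being the projector onto the range of `L*`. -/
noncomputable def I₂ [CompleteSpace F] (L : X →ₗ.[ℝ] F) (G : Set F) (l : X) (w : X) : EReal :=
  minSupportSq L G (rangeAdjointProj L (l - w))

/-- The null space `N(L)`, as a subset of the whole space. -/
def nullSpace (L : X →ₗ.[ℝ] F) : Set X :=
  {x | ∃ φ : L.domain, (φ : X) = x ∧ L φ = 0}

end Estimation

end MinimaxEstimation

/-! Write s(w) for `worstCase`, the supremum of |(w, φ)| over Lφ ∈ G. The noise has zero mean, so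
its cross term vanishes; its worst contribution is ‖u‖², from a random sign along u. Since G is
balanced, the worst shifted bias is s(ℓ - H*u) + |c|. Hence σ(ℓ, u, c) = (s(ℓ - H*u) + |c|)² + ‖u‖²
(`errorWithShift_eq`), and c = 0 is optimal.

Duality turns s into support functions: s(L*z) ≤ c(G, z) is immediate, and Hahn-Banach with the
gauge of G gives a z attaining equality whenever s(w) is finite
(`exists_adjoint_eq_of_worstCase_ne_top`). So s(w) is finite exactly on R(L*). Adding ‖u‖² to a
convex lower semicontinuous term gives a unique minimizer, by the parallelogram law.

If R(L) is closed, the open mapping theorem bounds s(w) by C‖w‖ on N(L)ᗮ. Then u is admissible iff ℓ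
- H*u ⊥ N(L), and I₂ is a finite continuous convex function. Separating its epigraph from a subspace
gives a subgradient p with Hp + 2u ∈ H(N(L))ᗮᗮ, which is H(N(L)) because this space is closed. -/

namespace MinimaxEstimation

/-! ### Worst-case noise -/

section Noise

variable {Y : Type*} [NormedAddCommGroup Y] [InnerProductSpace ℝ Y]
  [MeasurableSpace Y]

theorem IsNoiseLaw.integral_inner_sq_le {μ : Measure Y} (hμ : IsNoiseLaw μ) (u : Y) :
    ∫ η, ⟪u, η⟫_ℝ ^ 2 ∂μ ≤ ‖u‖ ^ 2 := by
  have h1 : MemLp (fun η : Y => ⟪u, η⟫_ℝ) 2 μ := hμ.memLp.const_inner u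
  have h2 : Integrable (fun η : Y => ⟪η, η⟫_ℝ) μ := by
    simpa only [real_inner_self_eq_norm_sq] using hμ.memLp.norm.integrable_sq
  calc ∫ η, ⟪u, η⟫_ℝ ^ 2 ∂μ ≤ ∫ η, ‖u‖ ^ 2 * ⟪η, η⟫_ℝ ∂μ := by
        refine integral_mono h1.integrable_sq (h2.const_mul _) fun η => ?_
        have := abs_real_inner_le_norm u η
        simp only [real_inner_self_eq_norm_sq]
        rw [← sq_abs, ← mul_pow]
        gcongr
    _ ≤ ‖u‖ ^ 2 * 1 := by
        rw [integral_const_mul]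
        gcongr
        exact hμ.second_moment_le
    _ = ‖u‖ ^ 2 := mul_one _

variable [CompleteSpace Y]

/-- The second moment of `b - (u, η)` for an admissible noise splits into `b²` and the second
moment of `(u, η)`. -/
theorem IsNoiseLaw.lintegral_sq_sub_inner {μ : Measure Y} (hμ : IsNoiseLaw μ) (u : Y) (b : ℝ) :
    ∫⁻ η, ENNReal.ofReal ((b - ⟪u, η⟫_ℝ) ^ 2) ∂μ
      = ENNReal.ofReal (b ^ 2 + ∫ η, ⟪u, η⟫_ℝ ^ 2 ∂μ) := by
  have := hμ.isProbabilityMeasure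
  have h1 : MemLp (fun η : Y => ⟪u, η⟫_ℝ) 2 μ := hμ.memLp.const_inner u
  have h1' : Integrable (fun η : Y => ⟪u, η⟫_ℝ) μ := h1.integrable (by norm_num)
  have h2 : Integrable (fun η : Y => ⟪u, η⟫_ℝ ^ 2) μ := h1.integrable_sq
  have h3 : ∫ η, ⟪u, η⟫_ℝ ∂μ = 0 := by
    rw [integral_inner (hμ.memLp.integrable (by norm_num)), hμ.mean_zero, inner_zero_right]
  have heq : ∀ η : Y, (b - ⟪u, η⟫_ℝ) ^ 2 = (b ^ 2 - 2 * b * ⟪u, η⟫_ℝ) + ⟪u, η⟫_ℝ ^ 2 :=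
    fun η => by ring
  have h4 : Integrable (fun η : Y => b ^ 2 - 2 * b * ⟪u, η⟫_ℝ) μ :=
    (integrable_const _).sub (h1'.const_mul _)
  rw [← ofReal_integral_eq_lintegral_ofReal]
  · simp_rw [heq]
    rw [integral_add h4 h2, integral_sub (integrable_const _) (h1'.const_mul _),
      integral_const_mul, h3]
    simp
  · simp_rw [heq]
    exact h4.add h2
  · exact Filter.Eventually.of_forall fun η => sq_nonneg _

theorem integral_half_dirac_add_dirac {Y V : Type*} [MeasurableSpace Y]
    [MeasurableSingletonClass Y] [NormedAddCommGroup V] [NormedSpace ℝ V] [CompleteSpace V]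
    (g : Y → V) (x y : Y) :
    ∫ η, g η ∂((2⁻¹ : ℝ≥0∞) • (Measure.dirac x + Measure.dirac y))
      = (2⁻¹ : ℝ) • (g x + g y) := by
  rw [integral_smul_measure, integral_add_measure, integral_dirac, integral_dirac]
  · simp
  · exact integrable_dirac (by simp)
  · exact integrable_dirac (by simp)

/-- The law of a random sign times a vector of norm at most `1` is admissible. -/
theorem exists_isNoiseLaw_integral_inner_sq [BorelSpace Y] (u : Y) :
    ∃ μ : Measure Y, IsNoiseLaw μ ∧ ∫ η, ⟪u, η⟫_ℝ ^ 2 ∂μ = ‖u‖ ^ 2 := by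
  -- For u = 0 the convention 0⁻¹ = 0 gives e = 0, and the law is still admissible.
  set e : Y := ‖u‖⁻¹ • u
  have he : ‖e‖ ≤ 1 := by
    rw [norm_smul, norm_inv, norm_norm]
    exact inv_mul_le_one
  have hue : ⟪u, e⟫_ℝ = ‖u‖ := by
    rw [real_inner_smul_right, real_inner_self_eq_norm_sq]
    rcases eq_or_ne ‖u‖ 0 with h | h
    · simp [h]
    · field_simp
  refine ⟨(2⁻¹ : ℝ≥0∞) • (Measure.dirac e + Measure.dirac (-e)), ⟨?_, ?_, ?_, ?_⟩, ?_⟩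
  · constructor
    simp [ENNReal.inv_two_add_inv_two]
  · refine MemLp.smul_measure ?_ (by simp)
    refine MemLp.of_bound ?_ 1 ?_
    · exact aestronglyMeasurable_dirac.add_measure aestronglyMeasurable_dirac
    · rw [ae_add_measure_iff, ae_dirac_eq, ae_dirac_eq]
      simp [he]
  · rw [integral_half_dirac_add_dirac]; simp
  · rw [integral_half_dirac_add_dirac]
    simp only [inner_neg_neg, real_inner_self_eq_norm_sq]
    rw [smul_eq_mul]
    nlinarith [norm_nonneg e]
  · rw [integral_half_dirac_add_dirac]
    simp only [inner_neg_right, hue, neg_sq]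
    rw [smul_eq_mul]
    ring

/-- One law is worst for every b, so the suprema over noise and over φ decouple. -/
theorem iSup_isNoiseLaw_lintegral [BorelSpace Y] (u : Y) (b : ℝ) :
    ⨆ (μ : Measure Y) (_ : IsNoiseLaw μ), ∫⁻ η, ENNReal.ofReal ((b - ⟪u, η⟫_ℝ) ^ 2) ∂μ
      = ENNReal.ofReal |b| ^ 2 + ENNReal.ofReal (‖u‖ ^ 2) := by
  rw [← ENNReal.ofReal_pow (abs_nonneg b), sq_abs, ← ENNReal.ofReal_add (sq_nonneg _) (sq_nonneg _)]
  apply le_antisymm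
  · refine iSup₂_le fun μ hμ => ?_
    rw [hμ.lintegral_sq_sub_inner]
    gcongr
    exact hμ.integral_inner_sq_le u
  · obtain ⟨μ, hμ, h⟩ := exists_isNoiseLaw_integral_inner_sq u
    refine le_iSup₂_of_le μ hμ ?_
    rw [hμ.lintegral_sq_sub_inner, h]

end Noise

/-! ### Closed form of the error -/

section WorstCase

variable {X F Y : Type*}
  [NormedAddCommGroup X] [InnerProductSpace ℝ X]
  [NormedAddCommGroup F] [InnerProductSpace ℝ F]

/-- The support function of `{φ ∈ D(L) : L φ ∈ G}` for balanced `G`: the supremum of `|(w, φ)|`. -/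
noncomputable def worstCase (L : X →ₗ.[ℝ] F) (G : Set F) (w : X) : ℝ≥0∞ :=
  ⨆ φ : {φ : L.domain // L φ ∈ G}, ENNReal.ofReal |⟪w, ((φ : L.domain) : X)⟫_ℝ|

theorem iSup_ofReal_abs_sub (L : X →ₗ.[ℝ] F) {G : Set F} (hG : Balanced ℝ G) (w : X) (c : ℝ)
    (h0 : (0 : F) ∈ G) :
    ⨆ φ : {φ : L.domain // L φ ∈ G}, ENNReal.ofReal |⟪w, ((φ : L.domain) : X)⟫_ℝ - c|
      = worstCase L G w + ENNReal.ofReal |c| := by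
  have : Nonempty {φ : L.domain // L φ ∈ G} := ⟨⟨0, by simpa using h0⟩⟩
  rw [worstCase, ENNReal.iSup_add]
  apply le_antisymm
  · refine iSup_mono fun φ => ?_
    rw [← ENNReal.ofReal_add (abs_nonneg _) (abs_nonneg _)]
    exact ENNReal.ofReal_le_ofReal (abs_sub _ _)
  · refine iSup_le fun φ => ?_
    rw [← ENNReal.ofReal_add (abs_nonneg _) (abs_nonneg _)]
    have hneg : L (-φ.1) ∈ G := by
      rw [LinearPMap.map_neg]
      exact hG.neg_mem_iff.mpr φ.2
    -- One of φ, -φ pairs with a sign opposite to that of c, and then the absolute values add.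
    have key : ∀ x y : ℝ, |x| + |y| ≤ |x - y| ∨ |x| + |y| ≤ |-x - y| := by grind
    rcases key ⟪w, ((φ : L.domain) : X)⟫_ℝ c with h | h
    · exact le_iSup_of_le φ (ENNReal.ofReal_le_ofReal h)
    · refine le_iSup_of_le ⟨-φ.1, hneg⟩ (ENNReal.ofReal_le_ofReal (h.trans_eq ?_))
      simp

variable [CompleteSpace X]
  [NormedAddCommGroup Y] [InnerProductSpace ℝ Y] [CompleteSpace Y] [MeasurableSpace Y]

/-- The residual is b - (u, η) with bias b = (ℓ - H*u, φ) - c, so the two worst cases add up. -/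
theorem errorWithShift_eq [BorelSpace Y] (L : X →ₗ.[ℝ] F) (H : X →L[ℝ] Y) {G : Set F}
    (hG : Balanced ℝ G) (h0 : (0 : F) ∈ G) (l : X) (u : Y) (c : ℝ) :
    errorWithShift L H G l u c
      = (worstCase L G (l - H.adjoint u) + ENNReal.ofReal |c|) ^ 2 + ENNReal.ofReal (‖u‖ ^ 2) := by
  have : Nonempty {φ : L.domain // L φ ∈ G} := ⟨⟨0, by simpa using h0⟩⟩
  rw [← iSup_ofReal_abs_sub L hG _ c h0, ENNReal.iSup_pow, ENNReal.iSup_add, errorWithShift,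
    iSup_subtype']
  refine iSup_congr fun φ => ?_
  rw [← iSup_isNoiseLaw_lintegral]
  refine iSup_congr fun μ => iSup_congr fun _ => lintegral_congr fun η => ?_
  rw [inner_add_right, inner_sub_left, ContinuousLinearMap.adjoint_inner_left]
  congr 2
  ring

theorem error_eq [BorelSpace Y] (L : X →ₗ.[ℝ] F) (H : X →L[ℝ] Y) {G : Set F}
    (hG : Balanced ℝ G) (h0 : (0 : F) ∈ G) (l : X) (u : Y) :
    error L H G l u = worstCase L G (l - H.adjoint u) ^ 2 + ENNReal.ofReal (‖u‖ ^ 2) := by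
  simp_rw [error, errorWithShift_eq L H hG h0]
  apply le_antisymm
  · exact iInf_le_of_le 0 (by simp)
  · refine le_iInf fun c => ?_
    gcongr
    exact le_self_add

end WorstCase

/-! ### Duality between the worst case and support functions -/

section Duality

variable {X F : Type*}
  [NormedAddCommGroup X] [InnerProductSpace ℝ X]
  [NormedAddCommGroup F] [InnerProductSpace ℝ F]

theorem supportFun_nonneg {G : Set F} (h0 : (0 : F) ∈ G) (z : F) : 0 ≤ supportFun G z :=
  le_iSup₂_of_le (f := fun f (_ : f ∈ G) => ((⟪z, f⟫_ℝ : ℝ) : EReal)) 0 h0 (by simp)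

theorem supportFun_lt_top {G : Set F} (hG : Bornology.IsBounded G) (z : F) :
    supportFun G z < ⊤ := by
  obtain ⟨C, hC⟩ := hG.exists_norm_le
  refine lt_of_le_of_lt (iSup₂_le fun f hf => ?_) (EReal.coe_lt_top (‖z‖ * C))
  exact EReal.coe_le_coe ((real_inner_le_norm z f).trans (by gcongr; exact hC f hf))

theorem abs_inner_le_worstCase (L : X →ₗ.[ℝ] F) (G : Set F) {w : X} (hw : worstCase L G w ≠ ⊤)
    (φ : L.domain) (hφ : L φ ∈ G) : |⟪w, (φ : X)⟫_ℝ| ≤ (worstCase L G w).toReal :=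
  (ENNReal.ofReal_le_iff_le_toReal hw).mp <|
    le_iSup (fun φ : {φ : L.domain // L φ ∈ G} =>
      ENNReal.ofReal |⟪w, ((φ : L.domain) : X)⟫_ℝ|) ⟨φ, hφ⟩

theorem worstCase_le_ofReal (L : X →ₗ.[ℝ] F) (G : Set F) {w : X} {C : ℝ}
    (h : ∀ φ : L.domain, L φ ∈ G → |⟪w, (φ : X)⟫_ℝ| ≤ C) :
    worstCase L G w ≤ ENNReal.ofReal C :=
  iSup_le fun φ => ENNReal.ofReal_le_ofReal (h φ.1 φ.2)

theorem inner_eq_zero_of_worstCase_ne_top (L : X →ₗ.[ℝ] F) {G : Set F} (h0 : (0 : F) ∈ G) {w : X}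
    (hw : worstCase L G w ≠ ⊤) (φ : L.domain) (hφ : L φ = 0) : ⟪w, (φ : X)⟫_ℝ = 0 := by
  by_contra hne
  have hpos : 0 < |⟪w, (φ : X)⟫_ℝ| := abs_pos.mpr hne
  set S := (worstCase L G w).toReal
  have hS : 0 ≤ S := ENNReal.toReal_nonneg
  -- Multiples of a null vector stay feasible; this one would pair with w to S + 1 in absolute
  -- value.
  have := abs_inner_le_worstCase L G hw (((S + 1) / |⟪w, (φ : X)⟫_ℝ|) • φ)
    (by rw [LinearPMap.map_smul, hφ, smul_zero]; exact h0)
  rw [Submodule.coe_smul, real_inner_smul_right, abs_mul, abs_div, abs_abs,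
    div_mul_cancel₀ _ hpos.ne', abs_of_nonneg (by positivity)] at this
  linarith

variable [CompleteSpace X]

theorem worstCase_le_supportFun (L : X →ₗ.[ℝ] F) [CompleteSpace F]
    (hL : Dense (L.domain : Set X)) {G : Set F}
    (hG : Balanced ℝ G) (h0 : (0 : F) ∈ G) (z : L.adjoint.domain) :
    (worstCase L G (L.adjoint z) : EReal) ≤ supportFun G (z : F) := by
  rw [← EReal.coe_toENNReal (supportFun_nonneg h0 (z : F)), EReal.coe_ennreal_le_coe_ennreal_iff]
  have key : ∀ f ∈ G, ENNReal.ofReal ⟪(z : F), f⟫_ℝ ≤ (supportFun G (z : F)).toENNReal := by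
    intro f hf
    have : ((⟪(z : F), f⟫_ℝ : ℝ) : EReal) ≤ supportFun G (z : F) :=
      le_iSup₂_of_le (f := fun f (_ : f ∈ G) => ((⟪(z : F), f⟫_ℝ : ℝ) : EReal)) f hf le_rfl
    simpa using EReal.toENNReal_le_toENNReal this
  refine iSup_le fun φ => ?_
  have hadj := L.adjoint_isFormalAdjoint hL z φ.1
  rw [hadj]
  rcases abs_choice ⟪(z : F), L φ.1⟫_ℝ with h | h
  · rw [h]
    exact key _ φ.2
  · rw [h, ← inner_neg_right]
    exact key _ (hG.neg_mem_iff.mpr φ.2)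

/-- The functional Lφ ↦ (w, φ) is dominated by s(w) times the gauge of G. A Hahn-Banach extension
keeps this bound and is continuous because G contains a ball; its Riesz vector is z. -/
theorem exists_adjoint_eq_of_worstCase_ne_top (L : X →ₗ.[ℝ] F) [CompleteSpace F]
    (hL : Dense (L.domain : Set X)) {G : Set F}
    (hGc : Convex ℝ G) (hGi : (0 : F) ∈ interior G) {w : X} (hw : worstCase L G w ≠ ⊤) :
    ∃ z : L.adjoint.domain, L.adjoint z = w ∧ supportFun G (z : F) ≤ (worstCase L G w : EReal) := by
  have h0 : (0 : F) ∈ G := interior_subset hGi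
  have habs : Absorbent ℝ G := absorbent_nhds_zero (mem_interior_iff_mem_nhds.mp hGi)
  set S := (worstCase L G w).toReal with hSdef
  have hS : 0 ≤ S := ENNReal.toReal_nonneg
  have hker := inner_eq_zero_of_worstCase_ne_top L h0 hw
  -- the functional `L φ ↦ (w, φ)` on the range of `L`
  obtain ⟨σ, hσ⟩ := L.toFun.rangeRestrict.exists_rightInverse_of_surjective
    L.toFun.range_rangeRestrict
  have hσL : ∀ x : LinearMap.range L.toFun, L (σ x) = (x : F) := fun x =>
    congrArg Subtype.val (LinearMap.congr_fun hσ x)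
  let f : F →ₗ.[ℝ] ℝ :=
    ⟨LinearMap.range L.toFun, ((innerₛₗ ℝ w).comp L.domain.subtype).comp σ⟩
  have hfL : ∀ φ : L.domain, f ⟨L φ, LinearMap.mem_range_self L.toFun φ⟩ = ⟪w, (φ : X)⟫_ℝ := by
    intro φ
    have := hker (σ ⟨L φ, LinearMap.mem_range_self L.toFun φ⟩ - φ)
      (by rw [LinearPMap.map_sub, hσL, sub_self])
    rw [Submodule.coe_sub, inner_sub_right, sub_eq_zero] at this
    exact this
  have hfN : ∀ x : f.domain, f x ≤ S * gauge G x := by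
    rintro ⟨_, φ, rfl⟩
    rw [show f ⟨L.toFun φ, _⟩ = _ from hfL φ]
    by_contra! hlt
    -- Room strictly above the gauge lets Lφ = b • y with y ∈ G and b < a. Feasibility of b⁻¹ • φ
    -- gives (w, φ) ≤ S * b, a contradiction; S = 0 needs its own choice of a.
    have hex : ∃ a, gauge G (L.toFun φ) < a ∧ S * a ≤ ⟪w, (φ : X)⟫_ℝ := by
      rcases hS.eq_or_lt with h | h
      · rw [← h, zero_mul] at hlt
        exact ⟨_, lt_add_one _, by rw [← h, zero_mul]; exact hlt.le⟩
      · exact ⟨⟪w, (φ : X)⟫_ℝ / S, (lt_div_iff₀' h).mpr hlt, (mul_div_cancel₀ _ h.ne').le⟩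
    obtain ⟨a, ha, hSa⟩ := hex
    obtain ⟨b, hb, hba, y, hy, hyx⟩ := exists_lt_of_gauge_lt habs ha
    have hφy : L (b⁻¹ • φ) = y := by
      rw [LinearPMap.map_smul]
      exact (congrArg (b⁻¹ • ·) hyx.symm).trans (inv_smul_smul₀ hb.ne' y)
    have hle := (le_abs_self _).trans (abs_inner_le_worstCase L G hw (b⁻¹ • φ) (hφy ▸ hy))
    rw [Submodule.coe_smul, real_inner_smul_right, inv_mul_le_iff₀ hb] at hle
    have hg := gauge_nonneg (s := G) (L.toFun φ)
    rcases hS.eq_or_lt with h | h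
    · rw [← hSdef, ← h] at hle
      nlinarith
    · nlinarith
  obtain ⟨g, hgf, hgN⟩ := exists_extension_of_le_sublinear f (fun x => S * gauge G x)
    (fun c hc x => by rw [gauge_smul_of_nonneg hc.le, smul_eq_mul]; ring)
    (fun x y => by rw [← mul_add]; gcongr; exact gauge_add_le hGc habs x y) hfN
  obtain ⟨r, hr, hball⟩ := Metric.mem_nhds_iff.mp (mem_interior_iff_mem_nhds.mp hGi)
  have hgb : ∀ x, g x ≤ S / r * ‖x‖ := fun x => by
    have := mul_gauge_le_norm hball (x := x)
    calc g x ≤ S * gauge G x := hgN x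
      _ ≤ S * (‖x‖ / r) := by gcongr; rwa [le_div_iff₀' hr]
      _ = S / r * ‖x‖ := by ring
  let gc : F →L[ℝ] ℝ := g.mkContinuous (S / r) fun x => by
    rw [Real.norm_eq_abs, abs_le']
    exact ⟨hgb x, by simpa using hgb (-x)⟩
  let z : F := (InnerProductSpace.toDual ℝ F).symm gc
  have hz : ∀ x, ⟪z, x⟫_ℝ = g x := fun x => InnerProductSpace.toDual_symm_apply
  have hzL : ∀ φ : L.domain, ⟪w, (φ : X)⟫_ℝ = ⟪z, L φ⟫_ℝ := fun φ => by
    rw [hz, ← hfL]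
    exact (hgf ⟨L φ, _⟩).symm
  refine ⟨⟨z, L.mem_adjoint_domain_of_exists z ⟨w, hzL⟩⟩, L.adjoint_apply_eq hL _ hzL, ?_⟩
  refine iSup₂_le fun x hx => ?_
  rw [← EReal.coe_toReal (x := (worstCase L G w : EReal)) (by simpa using hw) (by simp),
    EReal.toReal_coe_ennreal, EReal.coe_le_coe_iff]
  calc ⟪z, x⟫_ℝ = g x := hz x
    _ ≤ S * gauge G x := hgN x
    _ ≤ S * 1 := by gcongr; exact gauge_le_one_of_mem hx
    _ = S := mul_one S

variable [CompleteSpace F]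

theorem exists_adjoint_eq_iff_worstCase_ne_top (L : X →ₗ.[ℝ] F)
    (hL : Dense (L.domain : Set X)) {G : Set F} (hGc : Convex ℝ G) (hGb : Bornology.IsBounded G)
    (hG : Balanced ℝ G) (hGi : (0 : F) ∈ interior G) (w : X) :
    (∃ z : L.adjoint.domain, L.adjoint z = w) ↔ worstCase L G w ≠ ⊤ := by
  constructor
  · rintro ⟨z, rfl⟩ h
    have := worstCase_le_supportFun L hL hG (interior_subset hGi) z
    rw [h] at this
    exact (supportFun_lt_top hGb (z : F)).not_ge this
  · intro h
    obtain ⟨z, hz, -⟩ := exists_adjoint_eq_of_worstCase_ne_top L hL hGc hGi h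
    exact ⟨z, hz⟩

theorem exists_supportFun_sq_eq (L : X →ₗ.[ℝ] F)
    (hL : Dense (L.domain : Set X)) {G : Set F} (hGc : Convex ℝ G)
    (hG : Balanced ℝ G) (hGi : (0 : F) ∈ interior G) {w : X} (hw : worstCase L G w ≠ ⊤) :
    ∃ z : L.adjoint.domain, L.adjoint z = w ∧
      supportFun G (z : F) ^ 2 = ((worstCase L G w ^ 2 : ℝ≥0∞) : EReal) := by
  obtain ⟨z, rfl, hle⟩ := exists_adjoint_eq_of_worstCase_ne_top L hL hGc hGi hw
  refine ⟨z, rfl, ?_⟩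
  rw [le_antisymm hle (worstCase_le_supportFun L hL hG (interior_subset hGi) z),
    EReal.coe_ennreal_pow]

/-- This also covers w outside R(L*), where both sides are infinite. -/
theorem minSupportSq_eq (L : X →ₗ.[ℝ] F)
    (hL : Dense (L.domain : Set X)) {G : Set F} (hGc : Convex ℝ G)
    (hG : Balanced ℝ G) (hGi : (0 : F) ∈ interior G) (w : X) :
    minSupportSq L G w = ((worstCase L G w ^ 2 : ℝ≥0∞) : EReal) := by
  apply le_antisymm
  · rcases eq_or_ne (worstCase L G w) ⊤ with h | h
    · simp [h]
    · obtain ⟨z, hz, heq⟩ := exists_supportFun_sq_eq L hL hGc hG hGi h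
      exact iInf₂_le_of_le z hz heq.le
  · refine le_iInf₂ fun z hz => ?_
    rw [← hz, ← EReal.coe_toENNReal (supportFun_nonneg (interior_subset hGi) (z : F)),
      ← EReal.coe_ennreal_pow, EReal.coe_ennreal_le_coe_ennreal_iff]
    gcongr
    rw [← EReal.coe_ennreal_le_coe_ennreal_iff,
      EReal.coe_toENNReal (supportFun_nonneg (interior_subset hGi) (z : F))]
    exact worstCase_le_supportFun L hL hG (interior_subset hGi) z

end Duality

/-! ### Existence and uniqueness of the minimizer -/

section Minimizer

variable {Y : Type*} [NormedAddCommGroup Y] [InnerProductSpace ℝ Y]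

/-- Strong convexity: the parallelogram law supplies the gain ‖u - v‖² / 2 at the midpoint. -/
theorem two_mul_add_norm_sq_le {f : Y → ℝ≥0∞}
    (hf : ∀ u v, 2 * f ((2⁻¹ : ℝ) • (u + v)) ≤ f u + f v) (u v : Y) :
    2 * (f ((2⁻¹ : ℝ) • (u + v)) + ENNReal.ofReal (‖(2⁻¹ : ℝ) • (u + v)‖ ^ 2))
        + ENNReal.ofReal (‖u - v‖ ^ 2 / 2)
      ≤ (f u + ENNReal.ofReal (‖u‖ ^ 2)) + (f v + ENNReal.ofReal (‖v‖ ^ 2)) := by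
  have h : 2 * ENNReal.ofReal (‖(2⁻¹ : ℝ) • (u + v)‖ ^ 2) + ENNReal.ofReal (‖u - v‖ ^ 2 / 2)
      = ENNReal.ofReal (‖u‖ ^ 2) + ENNReal.ofReal (‖v‖ ^ 2) := by
    rw [← ENNReal.ofReal_add (by positivity) (by positivity), ← ENNReal.ofReal_ofNat 2,
      ← ENNReal.ofReal_mul (by positivity), ← ENNReal.ofReal_add (by positivity) (by positivity)]
    congr 1
    have := parallelogram_law_with_norm ℝ u v
    rw [norm_smul, mul_pow]
    norm_num
    nlinarith
  calc _ = 2 * f ((2⁻¹ : ℝ) • (u + v)) + (2 * ENNReal.ofReal (‖(2⁻¹ : ℝ) • (u + v)‖ ^ 2)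
        + ENNReal.ofReal (‖u - v‖ ^ 2 / 2)) := by ring
    _ ≤ (f u + f v) + (ENNReal.ofReal (‖u‖ ^ 2) + ENNReal.ofReal (‖v‖ ^ 2)) := by
        rw [h]
        gcongr
        exact hf u v
    _ = _ := by ring

/-- The midpoint cannot beat the infimum, so near-minimizers are close together. Small ε makes
minimizing sequences Cauchy; ε = 0 gives uniqueness. -/
theorem norm_sub_sq_le_of_le_iInf_add {f : Y → ℝ≥0∞}
    (hf : ∀ u v, 2 * f ((2⁻¹ : ℝ) • (u + v)) ≤ f u + f v)
    (hm : ⨅ u, (f u + ENNReal.ofReal (‖u‖ ^ 2)) ≠ ⊤) {ε : ℝ} (hε : 0 ≤ ε) {u v : Y}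
    (hu : f u + ENNReal.ofReal (‖u‖ ^ 2)
      ≤ (⨅ u, (f u + ENNReal.ofReal (‖u‖ ^ 2))) + ENNReal.ofReal ε)
    (hv : f v + ENNReal.ofReal (‖v‖ ^ 2)
      ≤ (⨅ u, (f u + ENNReal.ofReal (‖u‖ ^ 2))) + ENNReal.ofReal ε) :
    ‖u - v‖ ^ 2 ≤ 4 * ε := by
  set m := ⨅ u, (f u + ENNReal.ofReal (‖u‖ ^ 2)) with hmdef
  have h1 : 2 * m + ENNReal.ofReal (‖u - v‖ ^ 2 / 2) ≤ 2 * m + ENNReal.ofReal (2 * ε) :=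
    calc 2 * m + ENNReal.ofReal (‖u - v‖ ^ 2 / 2)
        ≤ 2 * (f ((2⁻¹ : ℝ) • (u + v)) + ENNReal.ofReal (‖(2⁻¹ : ℝ) • (u + v)‖ ^ 2))
          + ENNReal.ofReal (‖u - v‖ ^ 2 / 2) := by
          gcongr
          exact iInf_le (fun u => f u + ENNReal.ofReal (‖u‖ ^ 2)) _
      _ ≤ _ := two_mul_add_norm_sq_le hf u v
      _ ≤ (m + ENNReal.ofReal ε) + (m + ENNReal.ofReal ε) := add_le_add hu hv
      _ = 2 * m + ENNReal.ofReal (2 * ε) := by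
          rw [ENNReal.ofReal_mul zero_le_two, ENNReal.ofReal_ofNat]
          ring
  have h2 := (ENNReal.add_le_add_iff_left (ENNReal.mul_ne_top (by simp) hm)).mp h1
  rw [ENNReal.ofReal_le_ofReal_iff (by positivity)] at h2
  linarith

/-- A midpoint convex, lower semicontinuous, proper function plus `‖u‖²` has a unique minimizer. -/
theorem exists_unique_minimizer [CompleteSpace Y] {f : Y → ℝ≥0∞} (hlsc : LowerSemicontinuous f)
    (hf : ∀ u v, 2 * f ((2⁻¹ : ℝ) • (u + v)) ≤ f u + f v) {u₀ : Y} (hu₀ : f u₀ ≠ ⊤) :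
    ∃ uhat, ∀ u, f u + ENNReal.ofReal (‖u‖ ^ 2) = ⨅ v, (f v + ENNReal.ofReal (‖v‖ ^ 2))
      ↔ u = uhat := by
  set g : Y → ℝ≥0∞ := fun u => f u + ENNReal.ofReal (‖u‖ ^ 2)
  have hm : ⨅ u, g u ≠ ⊤ :=
    ne_top_of_le_ne_top (ENNReal.add_ne_top.mpr ⟨hu₀, ENNReal.ofReal_ne_top⟩) (iInf_le g u₀)
  have hglsc : LowerSemicontinuous g := hlsc.add
    (ENNReal.continuous_ofReal.comp (continuous_norm.pow 2)).lowerSemicontinuous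
  have hex : ∀ n : ℕ, ∃ u, g u < (⨅ u, g u) + ENNReal.ofReal (1 / (n + 1)) := fun n =>
    iInf_lt_iff.mp (ENNReal.lt_add_right hm (by simpa using by positivity))
  choose s hs using hex
  have hmono : ∀ n N : ℕ, N ≤ n → g (s n) ≤ (⨅ u, g u) + ENNReal.ofReal (1 / (N + 1)) :=
    fun n N h => (hs n).le.trans (by gcongr)
  have hcauchy : CauchySeq s := by
    refine cauchySeq_of_le_tendsto_0 (fun N : ℕ => √(4 * (1 / ((N : ℝ) + 1)))) ?_ ?_
    · intro n k N hn hk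
      rw [dist_eq_norm]
      exact Real.le_sqrt_of_sq_le
        (norm_sub_sq_le_of_le_iInf_add hf hm (by positivity) (hmono n N hn) (hmono k N hk))
    · have : Filter.Tendsto (fun N : ℕ => 4 * (1 / ((N : ℝ) + 1))) Filter.atTop (nhds (4 * 0)) :=
        tendsto_one_div_add_atTop_nhds_zero_nat.const_mul 4
      simpa using this.sqrt
  obtain ⟨uhat, hlim⟩ := cauchySeq_tendsto_of_complete hcauchy
  have hmin : g uhat = ⨅ u, g u := by
    refine le_antisymm (ENNReal.le_of_forall_pos_le_add fun ε hε _ => ?_) (iInf_le g uhat)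
    obtain ⟨N, hN⟩ := exists_nat_one_div_lt (K := ℝ) (NNReal.coe_pos.mpr hε)
    -- Sublevel sets are closed by lower semicontinuity and contain the tail of the sequence.
    have hmem : uhat ∈ g ⁻¹' Set.Iic ((⨅ u, g u) + ENNReal.ofReal (1 / (N + 1))) :=
      (hglsc.isClosed_preimage _).mem_of_tendsto hlim
        (Filter.eventually_atTop.mpr ⟨N, fun n hn => hmono n N hn⟩)
    refine hmem.out.trans ?_
    gcongr
    exact ENNReal.ofReal_le_of_le_toReal hN.le
  refine ⟨uhat, fun u => ⟨fun hu => ?_, fun hu => hu ▸ hmin⟩⟩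
  have := norm_sub_sq_le_of_le_iInf_add hf hm le_rfl (u := u) (v := uhat)
    (by rw [ENNReal.ofReal_zero, add_zero]; exact hu.le)
    (by rw [ENNReal.ofReal_zero, add_zero]; exact hmin.le)
  rw [mul_zero] at this
  exact sub_eq_zero.mp (norm_eq_zero.mp (pow_eq_zero_iff two_ne_zero |>.mp
    (le_antisymm this (sq_nonneg _))))

end Minimizer

/-! ### Regularity of the worst case, and bounds under closed range -/

section WorstCase

variable {X F : Type*}
  [NormedAddCommGroup X] [InnerProductSpace ℝ X]
  [NormedAddCommGroup F] [InnerProductSpace ℝ F]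

/-- As a supremum of continuous convex quadratics, the square inherits lower semicontinuity and
midpoint convexity term by term. -/
theorem worstCase_sq (L : X →ₗ.[ℝ] F) {G : Set F} (h0 : (0 : F) ∈ G) (w : X) :
    worstCase L G w ^ 2
      = ⨆ φ : {φ : L.domain // L φ ∈ G}, ENNReal.ofReal (⟪w, ((φ : L.domain) : X)⟫_ℝ ^ 2) := by
  have : Nonempty {φ : L.domain // L φ ∈ G} := ⟨⟨0, by simpa using h0⟩⟩
  rw [worstCase, ENNReal.iSup_pow]
  refine iSup_congr fun φ => ?_
  rw [← ENNReal.ofReal_pow (abs_nonneg _), sq_abs]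

theorem lowerSemicontinuous_worstCase_sq (L : X →ₗ.[ℝ] F) {G : Set F} (h0 : (0 : F) ∈ G) :
    LowerSemicontinuous fun w => worstCase L G w ^ 2 := by
  simp_rw [worstCase_sq L h0]
  refine lowerSemicontinuous_iSup fun φ => Continuous.lowerSemicontinuous ?_
  exact ENNReal.continuous_ofReal.comp (by fun_prop)

theorem two_mul_worstCase_sq_le (L : X →ₗ.[ℝ] F) {G : Set F} (h0 : (0 : F) ∈ G) (x y : X) :
    2 * worstCase L G ((2⁻¹ : ℝ) • (x + y)) ^ 2 ≤ worstCase L G x ^ 2 + worstCase L G y ^ 2 := by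
  simp_rw [worstCase_sq L h0]
  rw [ENNReal.mul_iSup]
  refine iSup_le fun φ => ?_
  refine le_trans ?_ (add_le_add (le_iSup _ φ) (le_iSup _ φ))
  rw [← ENNReal.ofReal_add (sq_nonneg _) (sq_nonneg _), ← ENNReal.ofReal_ofNat 2,
    ← ENNReal.ofReal_mul zero_le_two, real_inner_smul_left, inner_add_left]
  refine ENNReal.ofReal_le_ofReal ?_
  nlinarith [sq_nonneg (⟪x, ((φ : L.domain) : X)⟫_ℝ - ⟪y, ((φ : L.domain) : X)⟫_ℝ)]

theorem worstCase_add_le (L : X →ₗ.[ℝ] F) (G : Set F) (x y : X) :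
    worstCase L G (x + y) ≤ worstCase L G x + worstCase L G y := by
  refine iSup_le fun φ => ?_
  refine le_trans ?_ (add_le_add (le_iSup _ φ) (le_iSup _ φ))
  rw [← ENNReal.ofReal_add (abs_nonneg _) (abs_nonneg _), inner_add_left]
  exact ENNReal.ofReal_le_ofReal (abs_add_le _ _)

theorem worstCase_smul (L : X →ₗ.[ℝ] F) (G : Set F) (c : ℝ) (x : X) :
    worstCase L G (c • x) = ENNReal.ofReal |c| * worstCase L G x := by
  rw [worstCase, worstCase, ENNReal.mul_iSup]
  refine iSup_congr fun φ => ?_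
  rw [← ENNReal.ofReal_mul (abs_nonneg _), real_inner_smul_left, abs_mul]

/-- The null space `N(L)` as a subspace of the whole space. -/
def nullSubmodule (L : X →ₗ.[ℝ] F) : Submodule ℝ X :=
  (LinearMap.ker L.toFun).map L.domain.subtype

theorem coe_nullSubmodule (L : X →ₗ.[ℝ] F) : (nullSubmodule L : Set X) = nullSpace L := by
  ext x
  constructor
  · rintro ⟨φ, hφ, rfl⟩
    exact ⟨φ, rfl, hφ⟩
  · rintro ⟨φ, rfl, hφ⟩
    exact ⟨φ, hφ, rfl⟩

variable [CompleteSpace X] [CompleteSpace F]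

/-- A closed operator with closed range has a bounded right inverse on its range. -/
theorem exists_norm_le_of_isClosed_range (L : X →ₗ.[ℝ] F) (hL : L.IsClosed)
    (hR : IsClosed (Set.range fun φ : L.domain => L φ)) :
    ∃ C > 0, ∀ φ : L.domain, ∃ ψ : L.domain, L ψ = L φ ∧ ‖(ψ : X)‖ ≤ C * ‖L φ‖ := by
  have hR' : IsClosed (LinearMap.range L.toFun : Set F) := hR
  have : CompleteSpace L.graph := hL.completeSpace_coe
  have : CompleteSpace (LinearMap.range L.toFun) := hR'.completeSpace_coe
  have hmem : ∀ p : L.graph, (p : X × F).2 ∈ LinearMap.range L.toFun := fun p => by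
    obtain ⟨φ, -, hφ⟩ := L.mem_graph_iff.mp p.2
    exact ⟨φ, hφ⟩
  -- The second projection of the graph is a bounded surjection of Banach spaces, so the open
  -- mapping theorem applies.
  let T : L.graph →L[ℝ] LinearMap.range L.toFun :=
    ((ContinuousLinearMap.snd ℝ X F).comp L.graph.subtypeL).codRestrict _ hmem
  have hT : Function.Surjective T := by
    rintro ⟨_, φ, rfl⟩
    exact ⟨⟨(φ, L φ), L.mem_graph φ⟩, rfl⟩
  obtain ⟨C, hC, h⟩ := T.exists_preimage_norm_le hT
  refine ⟨C, hC, fun φ => ?_⟩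
  obtain ⟨p, hp, hpn⟩ := h ⟨L φ, φ, rfl⟩
  obtain ⟨ψ, hψ, hψL⟩ := L.mem_graph_iff.mp p.2
  refine ⟨ψ, hψL.trans (congrArg Subtype.val hp), ?_⟩
  rw [hψ]
  exact (norm_fst_le (p : X × F)).trans hpn

/-- Since w ⊥ N(L), each φ may be replaced by a preimage of Lφ of controlled norm. -/
theorem exists_worstCase_le_of_isClosed_range (L : X →ₗ.[ℝ] F) (hL : L.IsClosed)
    (hR : IsClosed (Set.range fun φ : L.domain => L φ)) {G : Set F}
    (hGb : Bornology.IsBounded G) :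
    ∃ C : ℝ, 0 ≤ C ∧ ∀ w ∈ (nullSubmodule L)ᗮ, worstCase L G w ≤ ENNReal.ofReal (C * ‖w‖) := by
  obtain ⟨C, hC, h⟩ := exists_norm_le_of_isClosed_range L hL hR
  obtain ⟨B, hB, hGB⟩ := hGb.exists_pos_norm_le
  refine ⟨C * B, by positivity, fun w hw => worstCase_le_ofReal L G fun φ hφ => ?_⟩
  obtain ⟨ψ, hψ, hψn⟩ := h φ
  have hker : ((φ - ψ : L.domain) : X) ∈ nullSubmodule L := by
    refine ⟨φ - ψ, ?_, rfl⟩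
    rw [SetLike.mem_coe, LinearMap.mem_ker, map_sub]
    exact sub_eq_zero.mpr hψ.symm
  have h0 : ⟪w, ((φ - ψ : L.domain) : X)⟫_ℝ = 0 :=
    Submodule.inner_left_of_mem_orthogonal hker hw
  rw [Submodule.coe_sub, inner_sub_right, sub_eq_zero] at h0
  rw [h0]
  calc |⟪w, (ψ : X)⟫_ℝ| ≤ ‖w‖ * ‖(ψ : X)‖ := abs_real_inner_le_norm _ _
    _ ≤ ‖w‖ * (C * B) := by
        gcongr
        exact hψn.trans (by gcongr; exact hGB _ hφ)
    _ = C * B * ‖w‖ := mul_comm _ _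

end WorstCase

/-! ### First-order conditions and subgradients -/

section Subgradient

theorem convexOn_seminorm_sub_sq {X : Type*} [NormedAddCommGroup X] [NormedSpace ℝ X]
    (r : Seminorm ℝ X) (l : X) :
    ConvexOn ℝ Set.univ fun w => r (l - w) ^ 2 := by
  have h := (r.convexOn.translate_right (-l)).pow (fun x _ => apply_nonneg r _) 2
  have heq : (fun w => r (l - w) ^ 2) = (r ∘ fun z => -l + z) ^ 2 := by
    ext w
    simp only [Pi.pow_apply, Function.comp_apply]
    rw [← map_neg_eq_map r (l - w), neg_sub, neg_add_eq_sub]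
  rw [heq]
  exact h

variable {X Y : Type*}
  [NormedAddCommGroup X] [InnerProductSpace ℝ X] [CompleteSpace X]
  [NormedAddCommGroup Y] [InnerProductSpace ℝ Y] [CompleteSpace Y]

/-- First-order condition along a subspace `K` for a minimizer of `‖v‖² + q (H* v)`. -/
theorem neg_two_inner_le_of_isMin {q : X → ℝ} (hq : ConvexOn ℝ Set.univ q) (H : X →L[ℝ] Y)
    (K : Submodule ℝ Y) (u : Y)
    (hmin : ∀ d ∈ K, q (H.adjoint u) + ‖u‖ ^ 2 ≤ q (H.adjoint (u + d)) + ‖u + d‖ ^ 2)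
    {d : Y} (hd : d ∈ K) : -2 * ⟪u, d⟫_ℝ ≤ q (H.adjoint (u + d)) - q (H.adjoint u) := by
  -- Compare u with u + t • d, use convexity on the segment and divide by t; the excess t * ‖d‖²
  -- vanishes as t → 0.
  have key : ∀ t : ℝ, 0 < t → t ≤ 1 →
      -2 * ⟪u, d⟫_ℝ ≤ q (H.adjoint (u + d)) - q (H.adjoint u) + t * ‖d‖ ^ 2 := by
    intro t ht ht1
    have h1 := hmin (t • d) (K.smul_mem t hd)
    have h2 := hq.2 (Set.mem_univ (H.adjoint u)) (Set.mem_univ (H.adjoint (u + d)))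
      (sub_nonneg.mpr ht1) ht.le (by ring)
    have h3 : (1 - t) • H.adjoint u + t • H.adjoint (u + d) = H.adjoint (u + t • d) := by
      simp only [map_add, map_smul]
      module
    rw [h3, smul_eq_mul, smul_eq_mul] at h2
    rw [norm_add_sq_real, real_inner_smul_right, norm_smul, Real.norm_eq_abs, mul_pow, sq_abs] at h1
    refine le_of_mul_le_mul_left ?_ ht
    nlinarith
  refine ge_of_tendsto (x := nhdsWithin (0 : ℝ) (Set.Ioi 0))
    (f := fun t => q (H.adjoint (u + d)) - q (H.adjoint u) + t * ‖d‖ ^ 2) ?_ ?_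
  · have : Continuous fun t : ℝ => q (H.adjoint (u + d)) - q (H.adjoint u) + t * ‖d‖ ^ 2 := by
      fun_prop
    have := this.tendsto 0
    rw [zero_mul, add_zero] at this
    exact this.mono_left nhdsWithin_le_nhds
  · filter_upwards [Ioc_mem_nhdsGT (zero_lt_one (α := ℝ))] with t ht
    exact key t ht.1 ht.2

/-- A minimizer of `‖v‖² + q (H* v)` over `u + K` admits a subgradient `p` of `q` at `H* u` with
`H p + 2 u ⊥ K`. -/
theorem exists_subgradient_of_isMin {q : X → ℝ} (hq : ConvexOn ℝ Set.univ q) (hqc : Continuous q)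
    (H : X →L[ℝ] Y) (K : Submodule ℝ Y) (u : Y)
    (hmin : ∀ d ∈ K, q (H.adjoint u) + ‖u‖ ^ 2 ≤ q (H.adjoint (u + d)) + ‖u + d‖ ^ 2) :
    ∃ p : X, (∀ y, q (H.adjoint u) + ⟪p, y - H.adjoint u⟫_ℝ ≤ q y) ∧ H p + (2 : ℝ) • u ∈ Kᗮ := by
  set a := H.adjoint u with ha
  -- A is the strict epigraph of the increment of q; B consists of the points (H*d, -2(u, d)), d ∈
  -- K. The first-order condition keeps them disjoint.
  let A : Set (X × ℝ) := {x | q (a + x.1) - q a < x.2}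
  let B : Submodule ℝ (X × ℝ) :=
    K.map (H.adjoint.toLinearMap.prod ((-2 : ℝ) • innerₛₗ ℝ u))
  have hA : Convex ℝ A := by
    have h := (hq.translate_right a).add_const (-q a)
    convert h.convex_strict_epigraph using 1
    ext x
    simp [A, sub_eq_add_neg]
  have hAo : IsOpen A := isOpen_lt (by fun_prop) (by fun_prop)
  have hdisj : Disjoint A (B : Set (X × ℝ)) := by
    refine Set.disjoint_left.mpr ?_
    rintro _ hx ⟨d, hd, rfl⟩
    have h1 := neg_two_inner_le_of_isMin hq H K u hmin hd
    have h2 : q (a + H.adjoint d) - q a < -2 * ⟪u, d⟫_ℝ := hx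
    rw [map_add] at h1
    exact absurd h2 h1.not_gt
  obtain ⟨f, c, hfA, hfB⟩ := geometric_hahn_banach_open hA hAo B.convex hdisj
  -- A functional bounded below on a subspace vanishes there: otherwise a multiple takes the value c
  -- - 1.
  have hB0 : ∀ b ∈ B, f b = 0 := by
    intro b hb
    by_contra hne
    have := hfB (((c - 1) / f b) • b) (B.smul_mem _ hb)
    rw [map_smul, smul_eq_mul, div_mul_cancel₀ _ hne] at this
    linarith
  have hc : c ≤ 0 := by simpa using hfB 0 B.zero_mem
  set β := -f (0, 1) with hβ
  -- The separating hyperplane is not vertical, so it can be normalized to have slope p.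
  have hβpos : 0 < β := by
    have := hfA (0, 1) (by simp [A])
    linarith
  have hsplit : ∀ x t, f (x, t) = f (x, 0) - t * β := by
    intro x t
    have : ((x, t) : X × ℝ) = (x, 0) + t • (0, 1) := by simp
    rw [this, map_add, map_smul, smul_eq_mul, hβ]
    ring
  let p : X := (InnerProductSpace.toDual ℝ X).symm
    (β⁻¹ • f.comp (ContinuousLinearMap.inl ℝ X ℝ))
  have hp : ∀ x, ⟪p, x⟫_ℝ = β⁻¹ * f (x, 0) := fun x => InnerProductSpace.toDual_symm_apply
  refine ⟨p, fun y => ?_, ?_⟩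
  -- The ε moves the point into the strict epigraph.
  · refine le_of_forall_pos_le_add fun ε hε => ?_
    have h1 := hfA (y - a, q y - q a + ε) (by simp [A, hε])
    rw [hsplit] at h1
    have h2 : β⁻¹ * f (y - a, 0) ≤ q y - q a + ε := by
      rw [inv_mul_le_iff₀ hβpos]
      linarith
    rw [hp]
    linarith
  · rw [Submodule.mem_orthogonal']
    intro d hd
    have h1 := hB0 (H.adjoint d, -2 * ⟪u, d⟫_ℝ) ⟨d, hd, rfl⟩
    rw [hsplit] at h1
    rw [inner_add_left, ← ContinuousLinearMap.adjoint_inner_right, hp, real_inner_smul_left]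
    have : f (H.adjoint d, 0) = β * (-2 * ⟪u, d⟫_ℝ) := by linarith
    rw [this, inv_mul_cancel_left₀ hβpos.ne']
    ring

end Subgradient

/-! ### The projector onto the range of the adjoint -/

section ClosedRange

variable {X F : Type*}
  [NormedAddCommGroup X] [InnerProductSpace ℝ X] [CompleteSpace X]
  [NormedAddCommGroup F] [InnerProductSpace ℝ F]

theorem adjoint_mem_nullSubmodule_orthogonal (L : X →ₗ.[ℝ] F) (hL : Dense (L.domain : Set X))
    (z : L.adjoint.domain) : L.adjoint z ∈ (nullSubmodule L)ᗮ := by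
  rw [Submodule.mem_orthogonal']
  rintro _ ⟨φ, hφ, rfl⟩
  rw [Submodule.subtype_apply, L.adjoint_isFormalAdjoint hL z φ, show L φ = 0 from hφ,
    inner_zero_right]

variable [CompleteSpace F]

theorem rangeAdjointProj_mem (L : X →ₗ.[ℝ] F) (hL : Dense (L.domain : Set X)) (w : X) :
    rangeAdjointProj L w ∈ (nullSubmodule L)ᗮ := by
  refine Submodule.topologicalClosure_minimal _ ?_ (Submodule.isClosed_orthogonal _)
    (Submodule.starProjection_apply_mem _ w)
  rintro _ ⟨z, rfl⟩
  exact adjoint_mem_nullSubmodule_orthogonal L hL z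

theorem rangeAdjointProj_adjoint (L : X →ₗ.[ℝ] F) (z : L.adjoint.domain) :
    rangeAdjointProj L (L.adjoint z) = L.adjoint z :=
  Submodule.starProjection_eq_self_iff.mpr (Submodule.le_topologicalClosure _ ⟨z, rfl⟩)

/-- The support function of `{φ : L φ ∈ G}` restricted to the range of `L*`, as a seminorm. -/
noncomputable def projWorstCase (L : X →ₗ.[ℝ] F) (G : Set F)
    (hfin : ∀ w, worstCase L G (rangeAdjointProj L w) ≠ ⊤) : Seminorm ℝ X :=
  Seminorm.of (fun w => (worstCase L G (rangeAdjointProj L w)).toReal)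
    (fun x y => by
      rw [map_add, ← ENNReal.toReal_add (hfin x) (hfin y)]
      exact ENNReal.toReal_mono (ENNReal.add_ne_top.mpr ⟨hfin x, hfin y⟩)
        (worstCase_add_le L G _ _))
    (fun c x => by
      rw [map_smul, worstCase_smul, ENNReal.toReal_mul, ENNReal.toReal_ofReal (abs_nonneg c),
        Real.norm_eq_abs])

/-- The projection lands in N(L)ᗮ, where the bound C‖w‖ gives finiteness and continuity. This makes
I₂ the square of a continuous seminorm of ℓ - w. -/
theorem exists_projWorstCase_eq (L : X →ₗ.[ℝ] F) (hL : Dense (L.domain : Set X))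
    (hLc : L.IsClosed) (hR : IsClosed (Set.range fun φ : L.domain => L φ)) {G : Set F}
    (hGb : Bornology.IsBounded G) :
    ∃ r : Seminorm ℝ X, Continuous r ∧
      ∀ w, worstCase L G (rangeAdjointProj L w) = ENNReal.ofReal (r w) := by
  obtain ⟨C, hC, h⟩ := exists_worstCase_le_of_isClosed_range L hLc hR hGb
  have hfin : ∀ w, worstCase L G (rangeAdjointProj L w) ≠ ⊤ := fun w =>
    ne_top_of_le_ne_top ENNReal.ofReal_ne_top (h _ (rangeAdjointProj_mem L hL w))
  refine ⟨projWorstCase L G hfin, ?_, fun w => (ENNReal.ofReal_toReal (hfin w)).symm⟩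
  refine Seminorm.continuous_of_le (q := (C.toNNReal : NNReal) • normSeminorm ℝ X) ?_ fun w => ?_
  · exact continuous_const.mul continuous_norm
  · refine ENNReal.toReal_le_of_le_ofReal (by positivity)
      ((h _ (rangeAdjointProj_mem L hL w)).trans (ENNReal.ofReal_le_ofReal ?_))
    change C * ‖rangeAdjointProj L w‖ ≤ C.toNNReal * ‖w‖
    rw [Real.coe_toNNReal C hC]
    gcongr
    exact Submodule.norm_starProjection_apply_le _ w

end ClosedRange

/-! ### Minimax estimates and their optimality criterion -/

section Estimates

variable {X F Y : Type*}
  [NormedAddCommGroup X] [InnerProductSpace ℝ X] [CompleteSpace X]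
  [NormedAddCommGroup F] [InnerProductSpace ℝ F]
  [NormedAddCommGroup Y] [InnerProductSpace ℝ Y] [CompleteSpace Y]

theorem exists_unique_error_minimizer [MeasurableSpace Y] [BorelSpace Y] (L : X →ₗ.[ℝ] F)
    (H : X →L[ℝ] Y) {G : Set F} (hG : Balanced ℝ G) (h0 : (0 : F) ∈ G) (l : X) {u₀ : Y}
    (hu₀ : worstCase L G (l - H.adjoint u₀) ≠ ⊤) :
    ∃ uhat, ∀ u, error L H G l u = ⨅ v, error L H G l v ↔ u = uhat := by
  simp_rw [error_eq L H hG h0]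
  refine exists_unique_minimizer (f := fun u => worstCase L G (l - H.adjoint u) ^ 2)
    ?_ (fun u v => ?_) (ENNReal.pow_ne_top hu₀)
  · exact (lowerSemicontinuous_worstCase_sq L h0).comp (g := fun u => l - H.adjoint u) (by fun_prop)
  · have : l - H.adjoint ((2⁻¹ : ℝ) • (u + v))
        = (2⁻¹ : ℝ) • ((l - H.adjoint u) + (l - H.adjoint v)) := by
      simp only [map_add, map_smul]
      module
    simp only [this]
    exact two_mul_worstCase_sq_le L h0 _ _

theorem isMinimaxEstimate_iff [MeasurableSpace Y] [BorelSpace Y] (L : X →ₗ.[ℝ] F)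
    (H : X →L[ℝ] Y) {G : Set F} (hG : Balanced ℝ G) (h0 : (0 : F) ∈ G) (l : X)
    (hfin : ⨅ v, error L H G l v ≠ ⊤) (u : Y) (c : ℝ) :
    IsMinimaxEstimate L H G l u c ↔ error L H G l u = (⨅ v, error L H G l v) ∧ c = 0 := by
  have hle : error L H G l u ≤ errorWithShift L H G l u c := iInf_le _ c
  constructor
  · intro h
    have h' : errorWithShift L H G l u c = ⨅ v, error L H G l v := h
    have hu : error L H G l u = ⨅ v, error L H G l v :=
      le_antisymm (hle.trans h'.le) (iInf_le _ u)
    refine ⟨hu, ?_⟩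
    have heq := h'.trans hu.symm
    rw [← hu, error_eq L H hG h0] at hfin
    rw [errorWithShift_eq L H hG h0, error_eq L H hG h0,
      ENNReal.add_left_inj ENNReal.ofReal_ne_top] at heq
    have hs : worstCase L G (l - H.adjoint u) ≠ ⊤ := fun h => hfin (by simp [h])
    -- Equal squares give s + |c| = s; as s is finite, c = 0.
    have h1 := (ENNReal.pow_right_strictMono two_ne_zero).injective heq
    have h2 : ENNReal.ofReal |c| = 0 := by
      rw [← ENNReal.add_right_inj hs, add_zero]
      exact h1
    exact abs_nonpos_iff.mp (ENNReal.ofReal_eq_zero.mp h2)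
  · rintro ⟨hu, rfl⟩
    have : errorWithShift L H G l u 0 = error L H G l u := by
      rw [errorWithShift_eq L H hG h0, error_eq L H hG h0]
      simp
    exact this.trans hu

/-- Identifies the directions d that preserve the constraint ℓ - H*u ⊥ N. -/
theorem mem_orthogonal_map_iff (N : Submodule ℝ X) (H : X →L[ℝ] Y) (d : Y) :
    d ∈ (N.map H.toLinearMap)ᗮ ↔ H.adjoint d ∈ Nᗮ := by
  simp only [Submodule.mem_orthogonal', Submodule.mem_map, forall_exists_index, and_imp,
    forall_apply_eq_imp_iff₂, ContinuousLinearMap.adjoint_inner_left]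
  rfl

/-- Minimizers of `‖v‖² + q (H* v)` over the admissible vectors are characterized by the
subdifferential of `q`. -/
theorem isMin_iff_exists_subgradient {q : X → ℝ} (hq : ConvexOn ℝ Set.univ q) (hqc : Continuous q)
    (H : X →L[ℝ] Y) (N : Submodule ℝ X) (hN : IsClosed (H '' N)) (l : X) {u : Y}
    (hu : l - H.adjoint u ∈ Nᗮ) :
    (∀ v, l - H.adjoint v ∈ Nᗮ → q (H.adjoint u) + ‖u‖ ^ 2 ≤ q (H.adjoint v) + ‖v‖ ^ 2) ↔
      ∃ p₀ ∈ N, ∃ p, (∀ y, q (H.adjoint u) + ⟪p, y - H.adjoint u⟫_ℝ ≤ q y) ∧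
        H p = (-2 : ℝ) • (u - H p₀) := by
  constructor
  · intro hmin
    have hcl : IsClosed (N.map H.toLinearMap : Set Y) := by simpa using hN
    have : CompleteSpace (N.map H.toLinearMap) := hcl.completeSpace_coe
    obtain ⟨p, hp, hpK⟩ := exists_subgradient_of_isMin hq hqc H (N.map H.toLinearMap)ᗮ u
      fun d hd => hmin _ <| by
        rw [map_add, ← sub_sub]
        exact Submodule.sub_mem _ hu ((mem_orthogonal_map_iff N H d).mp hd)
    rw [Submodule.orthogonal_orthogonal] at hpK
    obtain ⟨p₀, hp₀, heq⟩ := hpK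
    have heq' : H p₀ = H p + (2 : ℝ) • u := heq
    -- Halving absorbs the factor in -2(u - Hp₀), since the vector found satisfies Hp₀ = Hp + 2u.
    refine ⟨(2⁻¹ : ℝ) • p₀, N.smul_mem _ hp₀, p, hp, ?_⟩
    rw [map_smul, heq']
    module
  · rintro ⟨p₀, hp₀, p, hp, hHp⟩ v hv
    have h1 := hp (H.adjoint v)
    have hd : H.adjoint v - H.adjoint u ∈ Nᗮ := by
      have := Submodule.sub_mem _ hu hv
      rwa [sub_sub_sub_cancel_left] at this
    have h2 := Submodule.inner_right_of_mem_orthogonal hp₀ hd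
    rw [← map_sub, ContinuousLinearMap.adjoint_inner_right] at h1 h2
    -- The Hp₀ term drops because v - u ⊥ H(N), and -2(u, v - u) = ‖u‖² - ‖v‖² + ‖v - u‖².
    rw [hHp, real_inner_smul_left, inner_sub_left, h2, sub_zero, inner_sub_right,
      real_inner_self_eq_norm_sq] at h1
    have h3 := norm_sub_sq_real v u
    rw [real_inner_comm] at h3
    nlinarith [sq_nonneg ‖v - u‖]

end Estimates

end MinimaxEstimation

/-! ### The main theorem -/

open MinimaxEstimation in
theorem mainTheorem1
    {X F Y : Type*}
    [NormedAddCommGroup X] [InnerProductSpace ℝ X] [CompleteSpace X]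
    [NormedAddCommGroup F] [InnerProductSpace ℝ F] [CompleteSpace F]
    [NormedAddCommGroup Y] [InnerProductSpace ℝ Y] [CompleteSpace Y]
    [MeasurableSpace Y] [BorelSpace Y]
    (L : X →ₗ.[ℝ] F) (hL_dense : Dense (L.domain : Set X)) (hL_closed : L.IsClosed)
    (H : X →L[ℝ] Y)
    (G : Set F) (hG_convex : Convex ℝ G) (hG_bounded : Bornology.IsBounded G)
    (hG_closed : IsClosed G) (hG_balanced : Balanced ℝ G) (hG_int : (0 : F) ∈ interior G)
    (l : X) :
    (minimaxError L H G l < ⊤ ↔ (admissible L H l).Nonempty) ∧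
    ((admissible L H l).Nonempty →
      ∃ uhat ∈ admissible L H l,
        -- `(uhat, ·)` is the unique minimax estimate among all affine estimates
        (∀ (u : Y) (c : ℝ), IsMinimaxEstimate L H G l u c ↔ u = uhat ∧ c = 0) ∧
        -- the value of the error
        minimaxError L H G l = error L H G l uhat ^ (1 / 2 : ℝ) ∧
        (∀ u, error L H G l uhat ≤ error L H G l u) ∧
        (∀ u, ((error L H G l u : ENNReal) : EReal)
          = ((inner ℝ u u : ℝ) : EReal) + minSupportSq L G (l - H.adjoint u)) ∧
        -- the minimum in the formula for the error is attained
        (∀ u ∈ admissible L H l, ∃ z : L.adjoint.domain, L.adjoint z = l - H.adjoint u ∧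
          supportFun G (z : F) ^ 2 = minSupportSq L G (l - H.adjoint u)) ∧
        -- the characterization of `uhat` when `R(L)` and `H(N(L))` are closed
        (IsClosed (Set.range fun φ : L.domain => L φ) → IsClosed (H '' nullSpace L) →
          (∀ w, ∃ z : L.adjoint.domain, L.adjoint z = rangeAdjointProj L (l - w) ∧
            supportFun G (z : F) ^ 2 = I₂ L G l w) ∧
          ∀ u, u = uhat ↔
            u ∈ admissible L H l ∧
            ∃ p₀ ∈ nullSpace L,
              (-2 : ℝ) • (u - H p₀) ∈ H '' subdifferential (I₂ L G l) (H.adjoint u))) := by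
  have h0 : (0 : F) ∈ G := interior_subset hG_int
  have hadm : ∀ u, u ∈ admissible L H l ↔ worstCase L G (l - H.adjoint u) ≠ ⊤ := fun u =>
    exists_adjoint_eq_iff_worstCase_ne_top L hL_dense hG_convex hG_bounded hG_balanced hG_int _
  have herr : ∀ u, u ∈ admissible L H l ↔ error L H G l u ≠ ⊤ := fun u => by
    rw [hadm, error_eq L H hG_balanced h0]
    simp
  have hmm : minimaxError L H G l = (⨅ u, error L H G l u) ^ (1 / 2 : ℝ) := rfl
  have hne : (admissible L H l).Nonempty ↔ ⨅ u, error L H G l u ≠ ⊤ := by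
    simp [Set.Nonempty, herr, iInf_eq_top]
  refine ⟨?_, fun hU => ?_⟩
  · rw [hmm, hne, ENNReal.rpow_lt_top_iff_of_pos (by norm_num), lt_top_iff_ne_top]
  have hfin := hne.mp hU
  obtain ⟨u₀, hu₀⟩ := hU
  obtain ⟨uhat, huhat⟩ :=
    exists_unique_error_minimizer L H hG_balanced h0 l ((hadm u₀).mp hu₀)
  have hmin := (huhat uhat).mpr rfl
  refine ⟨uhat, (herr uhat).mpr (hmin ▸ hfin), fun u c => ?_, by rw [hmm, hmin],
    fun u => hmin ▸ iInf_le _ u, fun u => ?_, fun u hu => ?_, fun hR hHN => ?_⟩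
  · rw [isMinimaxEstimate_iff L H hG_balanced h0 l hfin, huhat]
  · rw [error_eq L H hG_balanced h0, EReal.coe_ennreal_add, add_comm,
      minSupportSq_eq L hL_dense hG_convex hG_balanced hG_int, EReal.coe_ennreal_ofReal,
      max_eq_left (sq_nonneg _), real_inner_self_eq_norm_sq]
  · rw [minSupportSq_eq L hL_dense hG_convex hG_balanced hG_int]
    exact exists_supportFun_sq_eq L hL_dense hG_convex hG_balanced hG_int ((hadm u).mp hu)
  obtain ⟨r, hrc, hr⟩ := exists_projWorstCase_eq L hL_dense hL_closed hR hG_bounded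
  have hI₂ : ∀ w, I₂ L G l w = ((r (l - w) ^ 2 : ℝ) : EReal) := fun w => by
    rw [I₂, minSupportSq_eq L hL_dense hG_convex hG_balanced hG_int, hr,
      ← ENNReal.ofReal_pow (apply_nonneg r _), EReal.coe_ennreal_ofReal, max_eq_left (sq_nonneg _)]
  refine ⟨fun w => ?_, fun u => ?_⟩
  · rw [I₂, minSupportSq_eq L hL_dense hG_convex hG_balanced hG_int]
    exact exists_supportFun_sq_eq L hL_dense hG_convex hG_balanced hG_int
      (by rw [hr]; exact ENNReal.ofReal_ne_top)
  -- the admissible vectors are those with `l - H* u ⊥ N(L)`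
  have hadmN : ∀ v, v ∈ admissible L H l ↔ l - H.adjoint v ∈ (nullSubmodule L)ᗮ := fun v => by
    constructor
    · rintro ⟨z, hz⟩
      exact hz ▸ adjoint_mem_nullSubmodule_orthogonal L hL_dense z
    · intro hv
      obtain ⟨C, -, hC⟩ := exists_worstCase_le_of_isClosed_range L hL_closed hR hG_bounded
      exact (hadm v).mpr (ne_top_of_le_ne_top ENNReal.ofReal_ne_top (hC _ hv))
  -- For admissible v the projector fixes ℓ - H*v, so the error is I₂(H*v) + ‖v‖².
  have herrq : ∀ v ∈ admissible L H l,
      error L H G l v = ENNReal.ofReal (r (l - H.adjoint v) ^ 2 + ‖v‖ ^ 2) := by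
    rintro v ⟨z, hz⟩
    have hs : worstCase L G (l - H.adjoint v) = ENNReal.ofReal (r (l - H.adjoint v)) := by
      rw [← hr, ← hz, rangeAdjointProj_adjoint]
    rw [error_eq L H hG_balanced h0, hs,
      ENNReal.ofReal_add (sq_nonneg _) (sq_nonneg _), ENNReal.ofReal_pow (apply_nonneg r _)]
  have hopt : ∀ u ∈ admissible L H l, (u = uhat ↔
      ∀ v, l - H.adjoint v ∈ (nullSubmodule L)ᗮ →
        r (l - H.adjoint u) ^ 2 + ‖u‖ ^ 2 ≤ r (l - H.adjoint v) ^ 2 + ‖v‖ ^ 2) := by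
    intro u hu
    rw [← huhat, ← (iInf_le _ u).ge_iff_eq', le_iInf_iff]
    refine forall_congr' fun v => ?_
    rw [← hadmN]
    -- Inadmissible v have infinite error and impose no condition.
    by_cases hv : v ∈ admissible L H l
    · rw [herrq u hu, herrq v hv, ENNReal.ofReal_le_ofReal_iff (by positivity)]
      simp [hv]
    · have : error L H G l v = ⊤ := by_contra fun h => hv ((herr v).mpr h)
      simp [hv, this]
  have hcrit : ∀ u ∈ admissible L H l, (u = uhat ↔ ∃ p₀ ∈ nullSpace L,
      (-2 : ℝ) • (u - H p₀) ∈ H '' subdifferential (I₂ L G l) (H.adjoint u)) := by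
    intro u hu
    rw [hopt u hu, isMin_iff_exists_subgradient (convexOn_seminorm_sub_sq r l)
      ((hrc.comp (by fun_prop)).pow 2) H (nullSubmodule L) (by rwa [coe_nullSubmodule]) l
      ((hadmN u).mp hu)]
    simp only [← coe_nullSubmodule, subdifferential, hI₂, ← EReal.coe_add, EReal.coe_le_coe_iff]
    rfl
  constructor
  · intro h
    have hu : u ∈ admissible L H l := h ▸ (herr uhat).mpr (hmin ▸ hfin)
    exact ⟨hu, (hcrit u hu).mp h⟩
  · rintro ⟨hu, h⟩
    exact (hcrit u hu).mpr h
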